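/- **Setting.** Let $n\ge 0$, let $D$ be a convex set with $\mathbb R^n_{\ge 0}\subseteq D\subseteq\mathbb R^n$ (for instance $D=\mathbb R^n$ or $D=\mathbb R^n_{\ge0}$), and let $f:D\to\mathbb R$ be convex and differentiable (one-sidedly at boundary points of $D$) and such that on $\mathbb R^n_{\ge0}$ it is non-negative and non-decreasing and $\nabla f(x)\ge\nabla f(x')$ whenever $x\ge x'\ge 0$ (all inequalities between vectors are coordinatewise). Let $A=(a_{tj})$ be a non-negative $m\times n$ matrix, $m\ge1$, whose rows arrive one by one, and let $d$ be a natural number such that each row has at most $d$ non-zero entries. Consider $$(P)\quad \min\{f(x): Ax\ge 1,\ x\ge 0\},\qquad (D)\quad \max\Big\{\sum_{i=1}^m y_i-f^\star(\mu): y^{\mathsf T}A\le\mu^{\mathsf T},\ y\ge0\Big\},\qquad f^\star(\mu)=\sup_{z\in D}\{\mu^{\mathsf T}z-f(z)\}.$$ **Algorithm.** Start with $x=0$ at time $\tau=0$. When row $t$ arrives, then as long as $\sum_j a_{tj}x_j<1$, increase $\tau$ at rate $1$ and change $x$ continuously so that $$\frac{\partial x_j}{\partial\tau}=\frac{a_{tj}x_j+\frac1d}{\nabla_j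 f(x)}\quad\text{if } a_{tj}>0,\qquad \frac{\partial x_j}{\partial\tau}=0\quad\text{if } a_{tj}=0;$$ the round ends when $\sum_j a_{tj}x_j\ge1$. A run of the algorithm is a continuous trajectory $x^\tau$ that obeys these rules, the equations being required, with $\nabla_jf(x)>0$ whenever $a_{tj}>0$, at all times strictly inside a round. Let $\bar x$ be the value of $x$ at the end of the run. **Ratio.** For $c>0$ put $$\varphi(c)=\inf_{z}\left(\frac{\min_{\ell}\left\{\frac{\nabla_\ell f(z)}{\nabla_\ell f(cz)}\right\}}{4\ln(1+2d^2)}-\frac{z^{\mathsf T}\nabla f(z)-f(z)}{f(cz)}\right)\in[-\infty,\infty],$$ where the minimum is over the $\ell\in\{1,\dots,n\}$ with $\nabla_\ell f(cz)>0$ and the infimum is over the $z\in\mathbb R^n_{\ge0}$ with $f(cz)>0$ for which at least one such $\ell$ exists. **Corollary (Online Minimization).** For every run of the algorithm: 1. the solution $x$ is non-decreasing over time, and $\bar x$ is feasible for $(P)$; 2. the competitive ratio of the algorithm is $\sup_{c>0}\varphi(c)$ (stated as optimum over algorithm's value), that is, for every feasible solution $x'$ of $(P)$, $$\Big(\sup_{c>0}\varphi(c)\Big)\cdot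 f(\bar x)\le f(x');$$ 3. if $f(0)=0$, then for every $\delta>0$ the dual can be fixed with hindsight with $\mu=\nabla f(\delta\bar x)$: there is $y\ge0$ with $y^{\mathsf T}A\le\mu^{\mathsf T}$ and $$\sum_{i=1}^m y_i-f^\star(\mu)\ \ge\ \varphi(1/\delta)\cdot f(\bar x).$$ -/

import Mathlib

open scoped Matrix

namespace OnlineCovering

/-- The `ℓ`-th coordinate `∇_ℓ f(z)` of the gradient of `f : D → ℝ` at `z ∈ D`, where `D ⊆ ℝⁿ`.
(The derivative is taken within `D`, so it is one-sided at boundary points of `D`; for `D = ℝⁿ`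
it is the usual gradient. A convex `D` that contains the nonnegative orthant has nonempty
interior, so this derivative is unique.) -/
noncomputable def grad {n : ℕ} (D : Set (Fin n → ℝ)) (f : (Fin n → ℝ) → ℝ)
    (z : Fin n → ℝ) (ℓ : Fin n) : ℝ :=
  fderivWithin ℝ f D z (Pi.single ℓ 1)

/-- The Fenchel dual `f⋆(μ) = sup_{z ∈ D} (μᵀ z - f z)` of `f : D → ℝ`, as an extended real. -/
noncomputable def fenchelDual {n : ℕ} (D : Set (Fin n → ℝ)) (f : (Fin n → ℝ) → ℝ)
    (μ : Fin n → ℝ) : EReal :=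
  ⨆ z ∈ D, ((μ ⬝ᵥ z - f z : ℝ) : EReal)

/-- Feasibility for the covering program `min {f x : A x ≥ 1, x ≥ 0}`. -/
def PrimalFeasible {m n : ℕ} (A : Matrix (Fin m) (Fin n) ℝ) (x : Fin n → ℝ) : Prop :=
  0 ≤ x ∧ ∀ i, 1 ≤ (A *ᵥ x) i

/-- Feasibility for the dual program `max {∑ᵢ yᵢ - f⋆(μ) : yᵀ A ≤ μᵀ, y ≥ 0}`. -/
def DualFeasible {m n : ℕ} (A : Matrix (Fin m) (Fin n) ℝ) (y : Fin m → ℝ) (μ : Fin n → ℝ) :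
    Prop :=
  0 ≤ y ∧ ∀ j, (y ᵥ* A) j ≤ μ j

/-- A run of the continuous-time fractional algorithm on the rows of `A`, which arrive one after
the other, with parameter `d`. Row `t` (for `t = 0, …, m - 1`) is processed during the time
interval `[T t, T (t + 1)]`, and `x τ` is the primal solution at time `τ`.

The algorithm starts at `x = 0`. A round lasts exactly as long as the new constraint is
unsatisfied (so it takes no time if the constraint already holds on arrival). During a round,
`∂x_j/∂τ = (a_{tj} x_j + 1/d) / ∇_j f(x)` for each `j` with `a_{tj} > 0`, the rate being
meaningful, i.e. `∇_j f(x) > 0`; all other coordinates are constant. The rates are required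
strictly inside a round only, so that a run may leave, with infinite speed, a point at which a
partial derivative vanishes, such as the origin for `f(x) = ‖x‖²`. -/
structure IsRun {m n : ℕ} (D : Set (Fin n → ℝ)) (f : (Fin n → ℝ) → ℝ)
    (A : Matrix (Fin m) (Fin n) ℝ) (d : ℕ) (T : Fin (m + 1) → ℝ) (x : ℝ → Fin n → ℝ) : Prop where
  time_zero : T 0 = 0
  start : x 0 = 0
  time_mono : Monotone T
  cont : ContinuousOn x (Set.Icc 0 (T (Fin.last m)))
  unsatisfied : ∀ t : Fin m, ∀ τ ∈ Set.Ico (T t.castSucc) (T t.succ), (A *ᵥ x τ) t < 1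
  satisfied : ∀ t : Fin m, 1 ≤ (A *ᵥ x (T t.succ)) t
  grad_pos : ∀ t : Fin m, ∀ τ ∈ Set.Ioo (T t.castSucc) (T t.succ), ∀ j : Fin n,
    0 < A t j → 0 < grad D f (x τ) j
  rate : ∀ t : Fin m, ∀ τ ∈ Set.Ioo (T t.castSucc) (T t.succ), ∀ j : Fin n,
    0 < A t j →
      HasDerivAt (fun s => x s j) ((A t j * x τ j + 1 / (d : ℝ)) / grad D f (x τ) j) τ
  rate_zero : ∀ t : Fin m, ∀ τ ∈ Set.Ioo (T t.castSucc) (T t.succ), ∀ j : Fin n,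
    A t j = 0 → HasDerivAt (fun s => x s j) 0 τ

/-- `min_ℓ ∇_ℓ f(z) / ∇_ℓ f(c z)`, the minimum being over the `ℓ` with `∇_ℓ f(c z) > 0`. -/
noncomputable def minGradRatio {n : ℕ} (D : Set (Fin n → ℝ)) (f : (Fin n → ℝ) → ℝ)
    (c : ℝ) (z : Fin n → ℝ) : ℝ :=
  ⨅ ℓ : {ℓ : Fin n // 0 < grad D f (c • z) ℓ}, grad D f z ℓ / grad D f (c • z) ℓ

/-- The points `z ≥ 0` at which the expression minimized over `z` makes sense: `f(c z) ≠ 0`,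
and at least one of the quotients `∇_ℓ f(z) / ∇_ℓ f(c z)` has a nonzero denominator. -/
def admissible {n : ℕ} (D : Set (Fin n → ℝ)) (f : (Fin n → ℝ) → ℝ) (c : ℝ) :
    Set (Fin n → ℝ) :=
  {z | 0 ≤ z ∧ 0 < f (c • z) ∧ ∃ ℓ, 0 < grad D f (c • z) ℓ}

/-- `min_z [ (min_ℓ ∇_ℓ f(z)/∇_ℓ f(c z)) / (4 ln (1 + 2 d²)) - (zᵀ∇f(z) - f(z)) / f(c z) ]`, as an
infimum in the extended reals. -/
noncomputable def ratioAt {n : ℕ} (D : Set (Fin n → ℝ)) (f : (Fin n → ℝ) → ℝ) (d : ℕ) (c : ℝ) :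
    EReal :=
  ⨅ z ∈ admissible D f c,
    ((minGradRatio D f c z / (4 * Real.log (1 + 2 * (d : ℝ) ^ 2))
      - (z ⬝ᵥ grad D f z - f z) / f (c • z) : ℝ) : EReal)

/-- The competitive ratio `max_{c > 0} min_z [ … ]`, as a supremum in the extended reals. -/
noncomputable def competitiveRatio {n : ℕ} (D : Set (Fin n → ℝ)) (f : (Fin n → ℝ) → ℝ) (d : ℕ) :
    EReal :=
  ⨆ (c : ℝ) (_ : 0 < c), ratioAt D f d c

end OnlineCovering

namespace OnlineCovering

/-! ### Convexity and the gradient within `D`. -/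

section Gradient

variable {n : ℕ} {D : Set (Fin n → ℝ)} {f : (Fin n → ℝ) → ℝ}

/-! Write L = ln(1 + 2d²) and g = ∇f(x̄). The core is `IsRun.value_le`: f(x̄) - f(0) ≤ (4L - 1) gᵀw
for every feasible w. For d ≥ 2 it comes from the potential Σ_j g_j w_j [log(w_j + d x_j) - log(w_j
+ x_j/8)]. It starts at 0, ends at most at log(8d) gᵀw, and grows at rate at least 3/4 while f grows
at rate at most 2; gradient monotonicity permits weighting by the final gradient throughout. For d =
1 the run never exceeds w, and convexity suffices.

Primal ratio: with z = x̄/c and R the minimal gradient quotient, convexity gives f(w) ≥ f(z) + (w -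
z)ᵀ∇f(z), and ∇f(z) ≥ R g, so a bound gᵀw ≥ f(x̄)/(4L) finishes. The spare -1 in the core estimate
yields this when 4L f(0) ≤ f(x̄). Otherwise f(0)/f(x̄) exceeds 1/(4L) and already bounds the ratio,
by `ratioAt_le_of_lt`; and f(0) ≤ f(w).

Dual: for f(0) = 0, the covering bound becomes by LP duality (`exists_packing_of_covering_bound`) a
packing y for g of value f(x̄)/(4L). Scaling by R makes it feasible for ∇f(δx̄), where the Fenchel
dual is explicit. -/

theorem dotProduct_grad (v z : Fin n → ℝ) :
    v ⬝ᵥ grad D f z = fderivWithin ℝ f D z v := by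
  conv_rhs => rw [pi_eq_sum_univ' v, map_sum]
  refine Finset.sum_congr rfl fun i _ => ?_
  rw [map_smul, smul_eq_mul]
  congr 3

/-- Restricting f to the segment from z to w reduces this to the slope inequality in one variable.
Only a one-sided derivative is needed, so boundary points of D cause no trouble. -/
theorem add_dotProduct_grad_le (hf : ConvexOn ℝ D f) (hf' : DifferentiableOn ℝ f D)
    {z w : Fin n → ℝ} (hz : z ∈ D) (hw : w ∈ D) :
    f z + (w - z) ⬝ᵥ grad D f z ≤ f w := by
  have hseg : Set.MapsTo (AffineMap.lineMap z w : ℝ → Fin n → ℝ) (Set.Icc 0 1) D :=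
    fun t ht => hf.1.lineMap_mem hz hw ht
  have hconv : ConvexOn ℝ (Set.Icc (0 : ℝ) 1) (f ∘ AffineMap.lineMap z w) :=
    (hf.comp_affineMap (AffineMap.lineMap z w)).subset hseg (convex_Icc 0 1)
  have hder : HasDerivWithinAt (f ∘ (AffineMap.lineMap z w : ℝ → Fin n → ℝ))
      (fderivWithin ℝ f D z (w - z)) (Set.Icc 0 1) 0 :=
    (hf' z hz).hasFDerivWithinAt.comp_hasDerivWithinAt_of_eq 0
      AffineMap.hasDerivWithinAt_lineMap hseg (by simp)
  have := hconv.le_slope_of_hasDerivWithinAt (by simp) (by simp) one_pos hder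
  rw [dotProduct_grad]
  simp only [slope_def_field, Function.comp_apply, AffineMap.lineMap_apply_one,
    AffineMap.lineMap_apply_zero, sub_zero, div_one] at this
  linarith

theorem grad_nonneg (hD : Set.Ici 0 ⊆ D) (hf' : DifferentiableOn ℝ f D)
    (hmono : MonotoneOn f (Set.Ici 0)) {z : Fin n → ℝ} (hz : 0 ≤ z) : 0 ≤ grad D f z := by
  intro ℓ
  have hray : ∀ t ∈ Set.Ici (0 : ℝ), 0 ≤ z + t • (Pi.single ℓ 1 : Fin n → ℝ) := fun t ht =>
    add_nonneg hz (smul_nonneg ht (Pi.single_nonneg.2 zero_le_one))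
  have hline : HasDerivWithinAt (fun t : ℝ => z + t • (Pi.single ℓ 1 : Fin n → ℝ))
      (Pi.single ℓ 1) (Set.Ici 0) 0 := by
    simpa using ((hasDerivWithinAt_id (0 : ℝ) (Set.Ici 0)).smul_const
      (Pi.single ℓ 1 : Fin n → ℝ)).const_add z
  have hder := (hf' z (hD hz)).hasFDerivWithinAt.comp_hasDerivWithinAt_of_eq 0 hline
    (fun t ht => hD (hray t ht)) (by simp)
  have hm : MonotoneOn (f ∘ fun t : ℝ => z + t • (Pi.single ℓ 1 : Fin n → ℝ)) (Set.Ici 0) := by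
    intro s hs t ht hst
    refine hmono (hray s hs) (hray t ht) (add_le_add_right ?_ z)
    exact smul_le_smul_of_nonneg_right hst (Pi.single_nonneg.2 zero_le_one)
  have := hm.derivWithin_nonneg (x := 0)
  rwa [hder.derivWithin (uniqueDiffOn_Ici 0 0 (by simp))] at this

/-- By the tangent inequality the supremum is attained at z. -/
theorem fenchelDual_grad (hf : ConvexOn ℝ D f) (hf' : DifferentiableOn ℝ f D)
    {z : Fin n → ℝ} (hz : z ∈ D) :
    fenchelDual D f (grad D f z) = ((grad D f z ⬝ᵥ z - f z : ℝ) : EReal) := by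
  refine le_antisymm (iSup₂_le fun w hw => EReal.coe_le_coe_iff.2 ?_)
    (le_iSup₂_of_le z hz le_rfl)
  have := add_dotProduct_grad_le hf hf' hz hw
  rw [sub_dotProduct, dotProduct_comm w, dotProduct_comm z] at this
  linarith

/-- Along a differentiable curve in `D`, the chain rule in terms of `grad`. -/
theorem hasDerivAt_comp_grad (hf' : DifferentiableOn ℝ f D) {x : ℝ → Fin n → ℝ} {τ a b : ℝ}
    (hτ : τ ∈ Set.Ioo a b) (hx : ∀ s ∈ Set.Ioo a b, x s ∈ D) {v : Fin n → ℝ}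
    (hv : ∀ j, HasDerivAt (fun s => x s j) (v j) τ) :
    HasDerivAt (fun s => f (x s)) (v ⬝ᵥ grad D f (x τ)) τ := by
  rw [dotProduct_grad]
  exact ((hf' _ (hx τ hτ)).hasFDerivWithinAt.comp_hasDerivWithinAt τ
    (hasDerivAt_pi.2 hv).hasDerivWithinAt hx).hasDerivAt (Ioo_mem_nhds hτ.1 hτ.2)

end Gradient

/-! ### Linear programming duality by separation. -/

/-- If every feasible `w` has `g ⬝ᵥ w ≥ V`, then the packing program has a solution of
value `V`. -/
theorem exists_packing_of_covering_bound {m n : ℕ} (hm : 0 < m) (A : Matrix (Fin m) (Fin n) ℝ)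
    {g : Fin n → ℝ} (hg : 0 ≤ g) {V : ℝ} (hV : 0 ≤ V)
    (h : ∀ w, PrimalFeasible A w → V ≤ g ⬝ᵥ w) :
    ∃ y : Fin m → ℝ, DualFeasible A y g ∧ ∑ i, y i = V := by
  have : Nonempty (Fin m) := ⟨⟨0, hm⟩⟩
  by_contra hcon
  push Not at hcon
  -- If no packing of value V exists, this compact convex set of loads misses the orthant below g. A
  -- separating functional, rescaled, will be a covering solution cheaper than V.
  set S : Set (Fin n → ℝ) := (fun y : Fin m → ℝ => (V • y) ᵥ* A) '' stdSimplex ℝ (Fin m) with hS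
  have hlin : IsLinearMap ℝ (fun y : Fin m → ℝ => (V • y) ᵥ* A) :=
    ⟨fun a b => by rw [smul_add, Matrix.add_vecMul],
      fun c a => by rw [smul_comm, Matrix.smul_vecMul]⟩
  have hSconv : Convex ℝ S := (convex_stdSimplex ℝ (Fin m)).is_linear_image hlin
  have hScomp : IsCompact S := (isCompact_stdSimplex ℝ (Fin m)).image
    (hlin.mk' _).continuous_of_finiteDimensional
  have hdisj : Disjoint (Set.Iic g) S := by
    rw [Set.disjoint_left]
    rintro _ hle ⟨y, hy, rfl⟩
    refine hcon (V • y) ⟨smul_nonneg hV hy.1, hle⟩ ?_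
    simp [← Finset.mul_sum, hy.2]
  obtain ⟨φ, u, v, hu, huv, hv⟩ := geometric_hahn_banach_closed_compact (convex_Iic g)
    isClosed_Iic hSconv hScomp hdisj
  set w : Fin n → ℝ := fun j => φ (Pi.single j 1) with hw
  have hφ : ∀ z, φ z = z ⬝ᵥ w := by
    intro z
    conv_lhs => rw [pi_eq_sum_univ' z, map_sum]
    refine Finset.sum_congr rfl fun i _ => ?_
    rw [map_smul, smul_eq_mul, hw]
  have hw0 : 0 ≤ w := by
    intro j
    by_contra hneg
    have hneg : w j < 0 := not_le.1 hneg
    have hgu := hu g (Set.self_mem_Iic)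
    -- If w j < 0, this point lies below g, yet φ takes the forbidden value u there.
    have := hu (g - ((φ g - u) / w j) • Pi.single j 1) (by
      rw [Set.mem_Iic, sub_le_self_iff]
      exact smul_nonneg (div_nonneg_of_nonpos (by linarith) hneg.le)
        (Pi.single_nonneg.2 zero_le_one))
    rw [map_sub, map_smul, smul_eq_mul] at this
    change φ g - (φ g - u) / w j * w j < u at this
    rw [div_mul_cancel₀ _ hneg.ne] at this
    linarith
  have hgu : g ⬝ᵥ w < u := hφ g ▸ hu g (Set.self_mem_Iic)
  have hgw : 0 ≤ g ⬝ᵥ w := dotProduct_nonneg_of_nonneg hg hw0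
  have hrow : ∀ i, v < V * (A *ᵥ w) i := by
    intro i
    have := hv _ ⟨Pi.single i 1, single_mem_stdSimplex ℝ i, rfl⟩
    rw [hφ] at this
    simp only [Matrix.smul_vecMul, smul_dotProduct, Matrix.single_one_vecMul, smul_eq_mul] at this
    exact this
  obtain ⟨i₀, hi₀⟩ := Finite.exists_min (A *ᵥ w)
  set α := (A *ᵥ w) i₀
  have hα : 0 < α := pos_of_mul_pos_right (by linarith [hrow i₀]) hV
  have := h (α⁻¹ • w) ⟨smul_nonneg (inv_nonneg.2 hα.le) hw0, fun i => by
    rw [Matrix.mulVec_smul, Pi.smul_apply, smul_eq_mul, inv_mul_eq_div, one_le_div hα]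
    exact hi₀ i⟩
  rw [dotProduct_smul, smul_eq_mul, inv_mul_eq_div, le_div_iff₀ hα] at this
  linarith [hrow i₀]

/-! ### The logarithmic potential and its constants. -/

section Potential

/-- The derivative with respect to `u` of the logarithmic potential
`w * (log (w + d * u) - log (w + ε * u))`. -/
theorem hasDerivAt_potential {w u d ε : ℝ} (hw : 0 ≤ w) (hu : 0 ≤ u) (hd : 0 ≤ d) (hε : 0 ≤ ε) :
    HasDerivAt (fun u => w * (Real.log (w + d * u) - Real.log (w + ε * u)))
      (w * (d / (w + d * u) - ε / (w + ε * u))) u := by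
  rcases hw.eq_or_lt with rfl | hw
  · simpa using hasDerivAt_const u (0 : ℝ)
  have h : ∀ c : ℝ, 0 ≤ c → HasDerivAt (fun u => Real.log (w + c * u)) (c / (w + c * u)) u := by
    intro c hc
    have h1 : HasDerivAt (fun u => w + c * u) c u := by
      simpa using ((hasDerivAt_id u).const_mul c).const_add w
    exact h1.log (by positivity)
  exact ((h d hd).sub (h ε hε)).const_mul w

theorem potential_deriv_nonneg {w u d ε : ℝ} (hw : 0 ≤ w) (hu : 0 ≤ u) (hε : 0 ≤ ε)
    (hεd : ε ≤ d) : 0 ≤ w * (d / (w + d * u) - ε / (w + ε * u)) := by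
  rcases hw.eq_or_lt with rfl | hw
  · simp
  have hd := hε.trans hεd
  refine mul_nonneg hw.le (sub_nonneg.2 ?_)
  rw [div_le_div_iff₀ (by positivity) (by positivity)]
  nlinarith

/-- Subtracting the second logarithm keeps the potential bounded in u, so no upper bound on the
run's coordinates is needed. -/
theorem potential_le {w u d ε : ℝ} (hw : 0 ≤ w) (hu : 0 ≤ u) (hε : 0 < ε) (hεd : ε ≤ d) :
    w * (Real.log (w + d * u) - Real.log (w + ε * u)) ≤ w * Real.log (d / ε) := by
  rcases hw.eq_or_lt with rfl | hw
  · simp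
  have hd := hε.trans_le hεd
  refine mul_le_mul_of_nonneg_left ?_ hw.le
  rw [← Real.log_div (by positivity) (by positivity)]
  refine Real.log_le_log (by positivity) ?_
  rw [div_le_div_iff₀ (by positivity) hε]
  nlinarith

/-- The growth of the potential when `u` increases at rate `a * u + 1 / d`. -/
theorem min_sub_le_potential_deriv {a w u d ε : ℝ} (ha : 0 ≤ a) (hw : 0 ≤ w) (hu : 0 ≤ u)
    (hd : 0 < d) (hε : 0 ≤ ε) :
    min (a * w) 1 - ε * (a * u + 1 / d)
      ≤ (a * u + 1 / d) * (w * (d / (w + d * u) - ε / (w + ε * u))) := by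
  rcases hw.eq_or_lt with rfl | hw
  · simp only [mul_zero, zero_le_one, min_eq_left, zero_sub, zero_mul, neg_nonpos]
    positivity
  -- The right side is (w · 1 + d u · a w) / (w + d u), a weighted average of 1 and a w.
  have h1 : min (a * w) 1 ≤ (a * u + 1 / d) * (w * (d / (w + d * u))) := by
    have : (a * u + 1 / d) * (w * (d / (w + d * u))) = w * (a * d * u + 1) / (w + d * u) := by
      field_simp
    rw [this, le_div_iff₀ (by positivity)]
    rcases le_total (a * w) 1 with h | h
    · rw [min_eq_left h]
      have : 0 ≤ (1 - a * w) * w := mul_nonneg (sub_nonneg.2 h) hw.le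
      nlinarith
    · rw [min_eq_right h]
      have : 0 ≤ (a * w - 1) * (d * u) := mul_nonneg (sub_nonneg.2 h) (by positivity)
      nlinarith
  have h2 : (a * u + 1 / d) * (w * (ε / (w + ε * u))) ≤ ε * (a * u + 1 / d) := by
    rw [mul_comm]
    refine mul_le_mul_of_nonneg_right ?_ (by positivity)
    rw [← mul_div_assoc, div_le_iff₀ (by positivity)]
    nlinarith [mul_nonneg (mul_nonneg hε hε) hu]
  rw [mul_sub, mul_sub]
  linarith

theorem one_le_sum_min_one {ι : Type*} {s : Finset ι} {p : ι → ℝ} (hp : ∀ i ∈ s, 0 ≤ p i)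
    (h : 1 ≤ ∑ i ∈ s, p i) : 1 ≤ ∑ i ∈ s, min (p i) 1 := by
  by_cases hbig : ∃ i ∈ s, 1 ≤ p i
  · obtain ⟨i, hi, h1⟩ := hbig
    calc (1 : ℝ) = min (p i) 1 := (min_eq_right h1).symm
      _ ≤ _ := Finset.single_le_sum (f := fun i => min (p i) 1)
        (fun j hj => le_min (hp j hj) zero_le_one) hi
  · push Not at hbig
    rwa [Finset.sum_congr rfl fun i hi => min_eq_left (hbig i hi).le]

/-- Since 1 + 2d² ≥ 9d/2 for d ≥ 2, it is enough that (8d)⁸e³ ≤ (9d/2)¹², which follows from d⁴ ≥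
16. The inequality fails at d = 1. -/
theorem log_bound {d : ℝ} (hd : 2 ≤ d) :
    8 / 3 * Real.log (8 * d) ≤ 4 * Real.log (1 + 2 * d ^ 2) - 1 := by
  have h1 : Real.log (9 / 2 * d) ≤ Real.log (1 + 2 * d ^ 2) :=
    Real.log_le_log (by positivity) (by nlinarith)
  have h2 : Real.log ((8 * d) ^ 8 * Real.exp 1 ^ 3) ≤ Real.log ((9 / 2 * d) ^ 12) := by
    refine Real.log_le_log (by positivity) ?_
    have he : Real.exp 1 ^ 3 ≤ (2.7182818286 : ℝ) ^ 3 :=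
      pow_le_pow_left₀ (Real.exp_pos 1).le Real.exp_one_lt_d9.le 3
    have hd4 : (2 : ℝ) ^ 4 ≤ d ^ 4 := pow_le_pow_left₀ (by norm_num) hd 4
    calc (8 * d) ^ 8 * Real.exp 1 ^ 3 ≤ (8 * d) ^ 8 * (2.7182818286 : ℝ) ^ 3 := by gcongr
      _ = (8 ^ 8 * 2.7182818286 ^ 3) * d ^ 8 := by ring
      _ ≤ ((9 / 2) ^ 12 * 2 ^ 4) * d ^ 8 :=
        mul_le_mul_of_nonneg_right (by norm_num) (by positivity)
      _ ≤ ((9 / 2) ^ 12 * d ^ 4) * d ^ 8 := by gcongr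
      _ = (9 / 2 * d) ^ 12 := by ring
  rw [Real.log_mul (by positivity) (by positivity), Real.log_pow, Real.log_pow, Real.log_pow,
    Real.log_exp] at h2
  norm_num at h2
  linarith

theorem one_lt_log_one_add_two_mul_sq {d : ℝ} (hd : 1 ≤ d) :
    1 < Real.log (1 + 2 * d ^ 2) := by
  rw [Real.lt_log_iff_exp_lt (by positivity)]
  nlinarith [Real.exp_one_lt_d9]

end Potential

/-! ### Monotonicity, round by round. -/

theorem monotoneOn_Icc_of_exists_hasDerivAt {h : ℝ → ℝ} {a b : ℝ}
    (hc : ContinuousOn h (Set.Icc a b))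
    (hder : ∀ τ ∈ Set.Ioo a b, ∃ h', HasDerivAt h h' τ ∧ 0 ≤ h') :
    MonotoneOn h (Set.Icc a b) := by
  refine monotoneOn_of_deriv_nonneg (convex_Icc a b) hc ?_ ?_ <;> rw [interior_Icc] <;>
    intro τ hτ <;> obtain ⟨h', hh, h0⟩ := hder τ hτ
  · exact hh.differentiableAt.differentiableWithinAt
  · rwa [hh.deriv]

theorem monotoneOn_of_rounds {α : Type*} [Preorder α] {m : ℕ} {T : Fin (m + 1) → ℝ}
    (hT : Monotone T) {h : ℝ → α}
    (hr : ∀ t : Fin m, MonotoneOn h (Set.Icc (T t.castSucc) (T t.succ))) :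
    MonotoneOn h (Set.Icc (T 0) (T (Fin.last m))) := by
  suffices ∀ k, MonotoneOn h (Set.Icc (T 0) (T k)) from this _
  intro k
  induction k using Fin.induction with
  | zero => simp
  | succ t ih =>
    have h0 : T 0 ≤ T t.castSucc := hT (Fin.zero_le _)
    have h1 : T t.castSucc ≤ T t.succ := hT (Fin.castSucc_le_succ t)
    rw [← Set.Icc_union_Icc_eq_Icc h0 h1]
    exact ih.union_right (hr t) (isGreatest_Icc h0) (isLeast_Icc h1)

theorem mulVec_eq_sum {m n : ℕ} (A : Matrix (Fin m) (Fin n) ℝ) (z : Fin n → ℝ) (t : Fin m) :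
    (A *ᵥ z) t = ∑ j, A t j * z j := rfl

/-! ### Analysis of a run. -/

namespace IsRun

variable {m n : ℕ} {D : Set (Fin n → ℝ)} {f : (Fin n → ℝ) → ℝ} {A : Matrix (Fin m) (Fin n) ℝ}
  {d : ℕ} {T : Fin (m + 1) → ℝ} {x : ℝ → Fin n → ℝ}

theorem round_subset (hrun : IsRun D f A d T x) (t : Fin m) :
    Set.Icc (T t.castSucc) (T t.succ) ⊆ Set.Icc 0 (T (Fin.last m)) :=
  Set.Icc_subset_Icc (hrun.time_zero ▸ hrun.time_mono (Fin.zero_le _))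
    (hrun.time_mono (Fin.le_last _))

theorem end_nonneg (hrun : IsRun D f A d T x) : 0 ≤ T (Fin.last m) :=
  hrun.time_zero ▸ hrun.time_mono (Fin.zero_le _)

theorem exists_row_pos (hrun : IsRun D f A d T x) (hA : ∀ i j, 0 ≤ A i j) (t : Fin m) :
    ∃ j, 0 < A t j := by
  by_contra! h
  have hz : A t = 0 := funext fun j => le_antisymm (h j) (hA t j)
  have := hrun.satisfied t
  rw [Matrix.mulVec, hz, zero_dotProduct] at this
  linarith

theorem one_le_sparsity (hrun : IsRun D f A d T x) (hm : 0 < m) (hA : ∀ i j, 0 ≤ A i j)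
    (hd : ∀ i, {j | A i j ≠ 0}.ncard ≤ d) : 1 ≤ d := by
  obtain ⟨j, hj⟩ := hrun.exists_row_pos hA ⟨0, hm⟩
  exact ((Set.ncard_pos (Set.toFinite _)).2 ⟨j, hj.ne'⟩).trans_le (hd ⟨0, hm⟩)

/-- The rate is nonnegative only once u = a x_j + 1/d is known to be, which looks circular. But u²
has derivative 2a u²/∇_j f ≥ 0 whatever the sign of u, so u cannot descend from its positive initial
value to 0. -/
theorem monotoneOn_round (hrun : IsRun D f A d T x) (hd : 1 ≤ d) (hA : ∀ i j, 0 ≤ A i j)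
    (t : Fin m) (h0 : 0 ≤ x (T t.castSucc)) :
    MonotoneOn x (Set.Icc (T t.castSucc) (T t.succ)) := by
  suffices ∀ j, MonotoneOn (fun s => x s j) (Set.Icc (T t.castSucc) (T t.succ)) from
    fun s hs s' hs' hss j => this j hs hs' hss
  intro j
  have hc : ContinuousOn (fun s => x s j) (Set.Icc (T t.castSucc) (T t.succ)) :=
    (continuous_apply j).comp_continuousOn (hrun.cont.mono (hrun.round_subset t))
  rcases (hA t j).eq_or_lt with ha | ha
  · exact monotoneOn_Icc_of_exists_hasDerivAt hc fun τ hτ =>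
      ⟨0, hrun.rate_zero t τ hτ j ha.symm, le_rfl⟩
  have hdpos : (0 : ℝ) < 1 / d := by positivity
  set u : ℝ → ℝ := fun s => A t j * x s j + 1 / (d : ℝ) with hu
  have huc : ContinuousOn u (Set.Icc (T t.castSucc) (T t.succ)) :=
    (continuousOn_const.mul hc).add continuousOn_const
  have hsq : MonotoneOn (fun s => u s ^ 2) (Set.Icc (T t.castSucc) (T t.succ)) := by
    refine monotoneOn_Icc_of_exists_hasDerivAt (huc.pow 2) fun τ hτ =>
      ⟨_, (((hrun.rate t τ hτ j ha).const_mul (A t j)).add_const (1 / (d : ℝ))).pow 2, ?_⟩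
    have hg := hrun.grad_pos t τ hτ j ha
    have : 0 ≤ 2 * A t j * (u τ ^ 2 / grad D f (x τ) j) := by positivity
    calc _ ≤ _ := this
      _ = _ := by rw [hu]; push_cast; ring
  have hpos : ∀ s ∈ Set.Icc (T t.castSucc) (T t.succ), 0 < u s := by
    intro s hs
    have hleft : T t.castSucc ∈ Set.Icc (T t.castSucc) (T t.succ) := ⟨le_rfl, hs.1.trans hs.2⟩
    have hu0 : 0 < u (T t.castSucc) := add_pos_of_nonneg_of_pos (mul_nonneg ha.le (h0 j)) hdpos
    by_contra! hneg
    obtain ⟨r, hr, hr0⟩ := intermediate_value_Icc' hs.1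
      (huc.mono (Set.Icc_subset_Icc_right hs.2)) ⟨hneg, hu0.le⟩
    have := hsq hleft ⟨hr.1, hr.2.trans hs.2⟩ hr.1
    simp only [hr0] at this
    nlinarith [pow_pos hu0 2]
  exact monotoneOn_Icc_of_exists_hasDerivAt hc fun τ hτ => ⟨_, hrun.rate t τ hτ j ha,
    div_nonneg (hpos τ (Set.Ioo_subset_Icc_self hτ)).le (hrun.grad_pos t τ hτ j ha).le⟩

theorem monotoneOn (hrun : IsRun D f A d T x) (hd : 1 ≤ d) (hA : ∀ i j, 0 ≤ A i j) :
    MonotoneOn x (Set.Icc 0 (T (Fin.last m))) := by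
  have h0 : ∀ k, 0 ≤ x (T k) := by
    intro k
    induction k using Fin.induction with
    | zero => rw [hrun.time_zero, hrun.start]
    | succ t ih =>
      have h1 : T t.castSucc ≤ T t.succ := hrun.time_mono (Fin.castSucc_le_succ t)
      exact ih.trans (hrun.monotoneOn_round hd hA t ih (Set.left_mem_Icc.2 h1)
        (Set.right_mem_Icc.2 h1) h1)
  have := monotoneOn_of_rounds hrun.time_mono fun t => hrun.monotoneOn_round hd hA t (h0 _)
  rwa [hrun.time_zero] at this

theorem nonneg (hrun : IsRun D f A d T x) (hd : 1 ≤ d) (hA : ∀ i j, 0 ≤ A i j) {τ : ℝ}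
    (hτ : τ ∈ Set.Icc 0 (T (Fin.last m))) : 0 ≤ x τ :=
  hrun.start ▸ hrun.monotoneOn hd hA (Set.left_mem_Icc.2 hrun.end_nonneg) hτ hτ.1

theorem le_end (hrun : IsRun D f A d T x) (hd : 1 ≤ d) (hA : ∀ i j, 0 ≤ A i j) {τ : ℝ}
    (hτ : τ ∈ Set.Icc 0 (T (Fin.last m))) : x τ ≤ x (T (Fin.last m)) :=
  hrun.monotoneOn hd hA hτ (Set.right_mem_Icc.2 hrun.end_nonneg) hτ.2

theorem end_primalFeasible (hrun : IsRun D f A d T x) (hd : 1 ≤ d) (hA : ∀ i j, 0 ≤ A i j) :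
    PrimalFeasible A (x (T (Fin.last m))) := by
  refine ⟨hrun.nonneg hd hA (Set.right_mem_Icc.2 hrun.end_nonneg), fun t => ?_⟩
  have hmem : T t.succ ∈ Set.Icc 0 (T (Fin.last m)) := hrun.round_subset t
    (Set.right_mem_Icc.2 (hrun.time_mono (Fin.castSucc_le_succ t)))
  refine (hrun.satisfied t).trans ?_
  rw [mulVec_eq_sum, mulVec_eq_sum]
  exact (Finset.sum_le_sum fun j _ => mul_le_mul_of_nonneg_left (hrun.le_end hd hA hmem j) (hA t j))

/-- The velocity of the run inside a round. -/
theorem hasDerivAt_coord (hrun : IsRun D f A d T x) (hA : ∀ i j, 0 ≤ A i j) {t : Fin m} {τ : ℝ}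
    (hτ : τ ∈ Set.Ioo (T t.castSucc) (T t.succ)) (j : Fin n) :
    HasDerivAt (fun s => x s j)
      (if 0 < A t j then (A t j * x τ j + 1 / (d : ℝ)) / grad D f (x τ) j else 0) τ := by
  split_ifs with h
  · exact hrun.rate t τ hτ j h
  · exact hrun.rate_zero t τ hτ j (le_antisymm (not_lt.1 h) (hA t j))

/-- The rate at which the primal value grows inside a round. -/
theorem hasDerivAt_value (hrun : IsRun D f A d T x) (hD : Set.Ici 0 ⊆ D)
    (hf' : DifferentiableOn ℝ f D) (hd : 1 ≤ d) (hA : ∀ i j, 0 ≤ A i j) {t : Fin m} {τ : ℝ}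
    (hτ : τ ∈ Set.Ioo (T t.castSucc) (T t.succ)) :
    HasDerivAt (fun s => f (x s)) (∑ j with 0 < A t j, (A t j * x τ j + 1 / (d : ℝ))) τ := by
  have := hasDerivAt_comp_grad hf' hτ (fun s hs => hD (hrun.nonneg hd hA
    (hrun.round_subset t (Set.Ioo_subset_Icc_self hs)))) (hrun.hasDerivAt_coord hA hτ)
  convert this using 1
  rw [Finset.sum_filter, dotProduct]
  refine Finset.sum_congr rfl fun j _ => ?_
  split_ifs with h
  · rw [div_mul_cancel₀ _ (hrun.grad_pos t τ hτ j h).ne']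
  · rw [zero_mul]

/-- The unsatisfied constraint contributes less than 1, and at most d summands 1/d contribute at
most 1. -/
theorem sum_rate_le_two (hrun : IsRun D f A d T x) (hd1 : 1 ≤ d) (hA : ∀ i j, 0 ≤ A i j)
    (hd : ∀ i, {j | A i j ≠ 0}.ncard ≤ d) {t : Fin m} {τ : ℝ}
    (hτ : τ ∈ Set.Ioo (T t.castSucc) (T t.succ)) :
    ∑ j with 0 < A t j, (A t j * x τ j + 1 / (d : ℝ)) ≤ 2 := by
  have hx := hrun.nonneg hd1 hA (hrun.round_subset t (Set.Ioo_subset_Icc_self hτ))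
  have h1 : ∑ j with 0 < A t j, A t j * x τ j ≤ (A *ᵥ x τ) t :=
    Finset.sum_le_univ_sum_of_nonneg fun j => mul_nonneg (hA t j) (hx j)
  have h2 := hrun.unsatisfied t τ (Set.Ioo_subset_Ico_self hτ)
  have h3 : (Finset.univ.filter fun j => 0 < A t j).card ≤ d := by
    rw [← Set.ncard_coe_finset]
    exact (Set.ncard_le_ncard (fun j hj => by simpa using (by simpa using hj : 0 < A t j).ne')
      (Set.toFinite _)).trans (hd t)
  have hd0 : (0 : ℝ) < d := by exact_mod_cast hd1
  rw [Finset.sum_add_distrib, Finset.sum_const, nsmul_eq_mul, mul_one_div]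
  have : ((Finset.univ.filter fun j => 0 < A t j).card : ℝ) / d ≤ 1 :=
    (div_le_one hd0).2 (by exact_mod_cast h3)
  linarith

theorem continuousOn_value (hrun : IsRun D f A d T x) (hD : Set.Ici 0 ⊆ D)
    (hf' : DifferentiableOn ℝ f D) (hd : 1 ≤ d) (hA : ∀ i j, 0 ≤ A i j) :
    ContinuousOn (fun s => f (x s)) (Set.Icc 0 (T (Fin.last m))) :=
  hf'.continuousOn.comp hrun.cont fun _ hs => hD (hrun.nonneg hd hA hs)

/-- If each row has a single entry, the run never exceeds a feasible solution. -/
theorem le_of_sparsity_one (hrun : IsRun D f A 1 T x) (hA : ∀ i j, 0 ≤ A i j)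
    (hd : ∀ i, {j | A i j ≠ 0}.ncard ≤ 1) {w : Fin n → ℝ} (hw : PrimalFeasible A w) :
    x (T (Fin.last m)) ≤ w := by
  suffices ∀ k, x (T k) ≤ w from this _
  intro k
  induction k using Fin.induction with
  | zero => rw [hrun.time_zero, hrun.start]; exact hw.1
  | succ t ih =>
    intro j
    by_contra! hlt
    have hle : T t.castSucc ≤ T t.succ := hrun.time_mono (Fin.castSucc_le_succ t)
    have hc : ContinuousOn (fun s => x s j) (Set.Icc (T t.castSucc) (T t.succ)) :=
      (continuous_apply j).comp_continuousOn (hrun.cont.mono (hrun.round_subset t))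
    -- If coordinate j overshoots w j, it passes through c strictly before the round ends. When
    -- a_{tj} > 0, the row is then already satisfied, since w satisfies it with a smaller value.
    obtain ⟨c, hwc, hcx⟩ := exists_between hlt
    obtain ⟨s, hs, hsc⟩ := intermediate_value_Icc hle hc ⟨(ih j).trans hwc.le, hcx.le⟩
    have hsc : x s j = c := hsc
    have hs' : s ∈ Set.Ico (T t.castSucc) (T t.succ) :=
      ⟨hs.1, hs.2.lt_of_ne fun h => by rw [← h, hsc] at hcx; exact lt_irrefl _ hcx⟩
    rcases (hA t j).eq_or_lt with ha | ha
    · have hm : AntitoneOn (fun s => x s j) (Set.Icc (T t.castSucc) (T t.succ)) := by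
        have := monotoneOn_Icc_of_exists_hasDerivAt hc.neg fun τ hτ =>
          ⟨-(0 : ℝ), (hrun.rate_zero t τ hτ j ha.symm).neg, neg_zero.ge⟩
        exact fun s hs s' hs' hss => neg_le_neg_iff.1 (this hs hs' hss)
      exact absurd (hm (Set.left_mem_Icc.2 hle) (Set.right_mem_Icc.2 hle) hle)
        (not_le.2 ((ih j).trans_lt hlt))
    · have hrow : ∀ z : Fin n → ℝ, (A *ᵥ z) t = A t j * z j := fun z => by
        refine Finset.sum_eq_single j (fun i _ hij => ?_) (fun h => absurd (Finset.mem_univ j) h)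
        by_contra hne
        exact hij ((Set.ncard_le_one (Set.toFinite _)).1 (hd t) i
          (left_ne_zero_of_mul hne) j ha.ne')
      have h1 := hrun.unsatisfied t s hs'
      have h2 := hw.2 t
      rw [hrow] at h1 h2
      rw [hsc] at h1
      exact absurd (h2.trans_lt' h1) (not_lt.2 (mul_le_mul_of_nonneg_left hwc.le ha.le))

/-- The growth of the primal value over a run is bounded by the linearized cost, at the final
point, of every feasible solution, when each row has at least two entries. -/
theorem value_le_of_two_le (hrun : IsRun D f A d T x) (hD : Set.Ici 0 ⊆ D)
    (hf' : DifferentiableOn ℝ f D) (hmono : MonotoneOn f (Set.Ici 0))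
    (hgrad : ∀ x x' : Fin n → ℝ, 0 ≤ x' → x' ≤ x → ∀ ℓ, grad D f x' ℓ ≤ grad D f x ℓ)
    (hA : ∀ i j, 0 ≤ A i j) (hd : ∀ i, {j | A i j ≠ 0}.ncard ≤ d) (hd2 : 2 ≤ d)
    {w : Fin n → ℝ} (hw : PrimalFeasible A w) :
    f (x (T (Fin.last m))) - f 0
      ≤ 8 / 3 * Real.log (8 * d) * (grad D f (x (T (Fin.last m))) ⬝ᵥ w) := by
  have hd1 : 1 ≤ d := by omega
  have hd0 : (2 : ℝ) ≤ d := by exact_mod_cast hd2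
  set xe := x (T (Fin.last m)) with hxe
  have hxe0 : 0 ≤ xe := hrun.nonneg hd1 hA (Set.right_mem_Icc.2 hrun.end_nonneg)
  have hg0 : 0 ≤ grad D f xe := grad_nonneg hD hf' hmono hxe0
  set ψ : Fin n → ℝ → ℝ := fun j u =>
    w j * (Real.log (w j + d * u) - Real.log (w j + 1 / 8 * u)) with hψ
  have hψd : ∀ j u, 0 ≤ u → HasDerivAt (ψ j)
      (w j * (d / (w j + d * u) - 1 / 8 / (w j + 1 / 8 * u))) u := fun j u hu =>
    hasDerivAt_potential (hw.1 j) hu (by linarith) (by norm_num)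
  -- With ε = 1/8 the unweighted potential growth is at least 1 - 2/8 = 3/4; the factor 8/3 turns
  -- this into 2, the bound on the growth of f.
  set h : ℝ → ℝ := fun s => 8 / 3 * ∑ j, grad D f xe j * ψ j (x s j) - f (x s) with hh
  have hcont : ContinuousOn h (Set.Icc 0 (T (Fin.last m))) := by
    refine ContinuousOn.sub (continuousOn_const.mul (continuousOn_finsetSum _ fun j _ =>
      continuousOn_const.mul ?_)) (hrun.continuousOn_value hD hf' hd1 hA)
    exact ContinuousOn.comp (t := Set.Ici 0) (g := ψ j)
      (fun u hu => (hψd j u hu).continuousAt.continuousWithinAt)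
      ((continuous_apply j).comp_continuousOn hrun.cont)
      fun s hs => hrun.nonneg hd1 hA hs j
  have hmon : MonotoneOn h (Set.Icc 0 (T (Fin.last m))) := by
    have := monotoneOn_of_rounds hrun.time_mono fun t => monotoneOn_Icc_of_exists_hasDerivAt
      (hcont.mono (hrun.round_subset t)) fun τ hτ => ?_
    · rwa [hrun.time_zero] at this
    have hτ' := hrun.round_subset t (Set.Ioo_subset_Icc_self hτ)
    have hx0 := hrun.nonneg hd1 hA hτ'
    refine ⟨_, ((HasDerivAt.fun_sum fun j _ => ((hψd j (x τ j) (hx0 j)).comp τ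
      (hrun.hasDerivAt_coord hA hτ j)).const_mul (grad D f xe j)).const_mul (8 / 3)).sub
      (hrun.hasDerivAt_value hD hf' hd1 hA hτ), ?_⟩
    have hS := hrun.sum_rate_le_two hd1 hA hd hτ
    have hrow : 1 ≤ ∑ j with 0 < A t j, A t j * w j := by
      refine (hw.2 t).trans_eq ?_
      rw [mulVec_eq_sum]
      refine (Finset.sum_subset (Finset.filter_subset _ _) fun j _ hj => ?_).symm
      have : A t j = 0 := le_antisymm (not_lt.1 fun h => hj (by simpa using h)) (hA t j)
      rw [this, zero_mul]
    have hmin := one_le_sum_min_one (fun j _ => mul_nonneg (hA t j) (hw.1 j)) hrow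
    have key : ∑ j with 0 < A t j,
        (min (A t j * w j) 1 - 1 / 8 * (A t j * x τ j + 1 / (d : ℝ)))
        ≤ ∑ j, grad D f xe j * (w j * (d / (w j + d * x τ j) - 1 / 8 / (w j + 1 / 8 * x τ j)) *
          (if 0 < A t j then (A t j * x τ j + 1 / (d : ℝ)) / grad D f (x τ) j else 0)) := by
      rw [Finset.sum_filter]
      refine Finset.sum_le_sum fun j _ => ?_
      split_ifs with ha
      · refine (min_sub_le_potential_deriv (hA t j) (hw.1 j) (hx0 j) (by linarith)
          (by norm_num)).trans ?_
        have hgp := hrun.grad_pos t τ hτ j ha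
        -- The run divides by the current gradient and the potential is weighted by the final,
        -- larger one; the quotient can be dropped because the potential is nondecreasing in u.
        have hgl : 1 ≤ grad D f xe j / grad D f (x τ) j :=
          (one_le_div hgp).2 (hgrad xe (x τ) hx0 (hrun.le_end hd1 hA hτ') j)
        have hnn : 0 ≤ (A t j * x τ j + 1 / (d : ℝ)) *
            (w j * (d / (w j + d * x τ j) - 1 / 8 / (w j + 1 / 8 * x τ j))) :=
          mul_nonneg (add_nonneg (mul_nonneg ha.le (hx0 j)) (by positivity))
            (potential_deriv_nonneg (hw.1 j) (hx0 j) (by norm_num) (by linarith))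
        refine (le_mul_of_one_le_left hnn hgl).trans_eq ?_
        ring
      · simp
    rw [Finset.sum_sub_distrib, ← Finset.mul_sum] at key
    linarith
  have hfin := hmon (Set.left_mem_Icc.2 hrun.end_nonneg) (Set.right_mem_Icc.2 hrun.end_nonneg)
    hrun.end_nonneg
  have hstart : h 0 = - f 0 := by simp [hh, hψ, hrun.start]
  have hend : ∑ j, grad D f xe j * ψ j (xe j) ≤ Real.log (8 * d) * (grad D f xe ⬝ᵥ w) := by
    rw [dotProduct, Finset.mul_sum]
    refine Finset.sum_le_sum fun j _ => ?_
    have := potential_le (d := d) (ε := 1 / 8) (hw.1 j) (hxe0 j) (by norm_num) (by linarith)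
    rw [show (d : ℝ) / (1 / 8) = 8 * d by ring] at this
    calc _ ≤ _ := mul_le_mul_of_nonneg_left this (hg0 j)
      _ = _ := by ring
  rw [hstart] at hfin
  have : h (T (Fin.last m)) = 8 / 3 * ∑ j, grad D f xe j * ψ j (xe j) - f xe := rfl
  linarith

/-- The growth of the primal value over a run is bounded by the linearized cost, at the final
point, of every feasible solution. -/
theorem value_le (hrun : IsRun D f A d T x) (hm : 0 < m) (hD : Set.Ici 0 ⊆ D)
    (hf : ConvexOn ℝ D f)
    (hf' : DifferentiableOn ℝ f D) (hmono : MonotoneOn f (Set.Ici 0))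
    (hgrad : ∀ x x' : Fin n → ℝ, 0 ≤ x' → x' ≤ x → ∀ ℓ, grad D f x' ℓ ≤ grad D f x ℓ)
    (hA : ∀ i j, 0 ≤ A i j) (hd : ∀ i, {j | A i j ≠ 0}.ncard ≤ d)
    {w : Fin n → ℝ} (hw : PrimalFeasible A w) :
    f (x (T (Fin.last m))) - f 0
      ≤ (4 * Real.log (1 + 2 * (d : ℝ) ^ 2) - 1) * (grad D f (x (T (Fin.last m))) ⬝ᵥ w) := by
  have hd1 := hrun.one_le_sparsity hm hA hd
  have hxe0 := hrun.nonneg hd1 hA (Set.right_mem_Icc.2 hrun.end_nonneg)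
  have hg0 := grad_nonneg hD hf' hmono hxe0
  have hgw := dotProduct_nonneg_of_nonneg hg0 hw.1
  rcases hd1.eq_or_lt with rfl | hd2
  · have h1 := add_dotProduct_grad_le hf hf' (hD hxe0) (hD (Set.self_mem_Ici (a := 0)))
    have h2 : grad D f (x (T (Fin.last m))) ⬝ᵥ x (T (Fin.last m))
        ≤ grad D f (x (T (Fin.last m))) ⬝ᵥ w :=
      dotProduct_le_dotProduct_of_nonneg_left (hrun.le_of_sparsity_one hA hd hw) hg0
    have h3 := one_lt_log_one_add_two_mul_sq (d := ((1 : ℕ) : ℝ)) (by simp)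
    rw [zero_sub, neg_dotProduct, dotProduct_comm] at h1
    nlinarith
  · exact (hrun.value_le_of_two_le hD hf' hmono hgrad hA hd hd2 hw).trans
      (mul_le_mul_of_nonneg_right (log_bound (by exact_mod_cast hd2)) hgw)

/-- The final value exceeds the initial one, and the gradient there has a positive coordinate. -/
theorem value_lt_and_exists_grad_pos (hrun : IsRun D f A d T x) (hm : 0 < m)
    (hD : Set.Ici 0 ⊆ D) (hf' : DifferentiableOn ℝ f D)
    (hmono : MonotoneOn f (Set.Ici 0))
    (hgrad : ∀ x x' : Fin n → ℝ, 0 ≤ x' → x' ≤ x → ∀ ℓ, grad D f x' ℓ ≤ grad D f x ℓ)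
    (hA : ∀ i j, 0 ≤ A i j) (hd : 1 ≤ d) :
    f 0 < f (x (T (Fin.last m))) ∧ ∃ ℓ, 0 < grad D f (x (T (Fin.last m))) ℓ := by
  -- Some round has positive length, since the origin violates every constraint; f strictly
  -- increases during it.
  obtain ⟨t, ht⟩ : ∃ t : Fin m, T t.castSucc < T t.succ := by
    by_contra! hcon
    have : ∀ k, T k ≤ 0 := fun k => by
      induction k using Fin.induction with
      | zero => exact hrun.time_zero.le
      | succ t ih => exact (hcon t).trans ih
    have h0 : T (Fin.succ ⟨0, hm⟩) = 0 :=
      le_antisymm (this _) (hrun.time_zero ▸ hrun.time_mono (Fin.zero_le _))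
    have := hrun.satisfied ⟨0, hm⟩
    rw [h0, hrun.start, Matrix.mulVec_zero, Pi.zero_apply] at this
    linarith
  have hsub := hrun.round_subset t
  obtain ⟨j, hj⟩ := hrun.exists_row_pos hA t
  have hstrict : StrictMonoOn (fun s => f (x s)) (Set.Icc (T t.castSucc) (T t.succ)) := by
    refine strictMonoOn_of_deriv_pos (convex_Icc _ _)
      ((hrun.continuousOn_value hD hf' hd hA).mono hsub) fun τ hτ => ?_
    rw [interior_Icc] at hτ
    rw [(hrun.hasDerivAt_value hD hf' hd hA hτ).deriv]
    have hx := hrun.nonneg hd hA (hsub (Set.Ioo_subset_Icc_self hτ))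
    refine Finset.sum_pos (fun i _ => ?_) ⟨j, by simpa using hj⟩
    have := mul_nonneg (hA t i) (hx i)
    positivity
  have hl := Set.left_mem_Icc.2 ht.le
  have hr := Set.right_mem_Icc.2 ht.le
  refine ⟨?_, j, ?_⟩
  · calc f 0 ≤ f (x (T t.castSucc)) := hmono (Set.self_mem_Ici) (hrun.nonneg hd hA (hsub hl))
          (hrun.nonneg hd hA (hsub hl))
      _ < f (x (T t.succ)) := hstrict hl hr ht
      _ ≤ _ := hmono (hrun.nonneg hd hA (hsub hr))
          (hrun.nonneg hd hA (Set.right_mem_Icc.2 hrun.end_nonneg)) (hrun.le_end hd hA (hsub hr))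
  · obtain ⟨τ, hτ⟩ := exists_between ht
    have hτ' := hsub (Set.Ioo_subset_Icc_self hτ)
    exact (hrun.grad_pos t τ hτ j hj).trans_le
      (hgrad _ _ (hrun.nonneg hd hA hτ') (hrun.le_end hd hA hτ') j)

end IsRun

/-! ### Bounds on the ratio. -/

section Ratio

variable {n : ℕ} {D : Set (Fin n → ℝ)} {f : (Fin n → ℝ) → ℝ} {c : ℝ} {z : Fin n → ℝ}

theorem minGradRatio_nonneg (hz : 0 ≤ grad D f z) : 0 ≤ minGradRatio D f c z :=
  Real.iInf_nonneg fun ℓ => div_nonneg (hz ℓ) ℓ.2.le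

/-- Coordinates left out of the minimum have zero gradient at c z, so the inequality holds for all
ℓ. -/
theorem minGradRatio_mul_grad_le (hz : 0 ≤ grad D f z) (hcz : 0 ≤ grad D f (c • z)) (ℓ : Fin n) :
    minGradRatio D f c z * grad D f (c • z) ℓ ≤ grad D f z ℓ := by
  rcases (hcz ℓ).eq_or_lt with h | h
  · rw [← h]
    simpa using hz ℓ
  · rw [← le_div_iff₀ h]
    exact ciInf_le (Set.finite_range _).bddBelow
      (⟨ℓ, h⟩ : {ℓ : Fin n // 0 < grad D f (c • z) ℓ})

theorem minGradRatio_mul_dotProduct_le (hz : 0 ≤ grad D f z) (hcz : 0 ≤ grad D f (c • z))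
    {v : Fin n → ℝ} (hv : 0 ≤ v) :
    minGradRatio D f c z * (v ⬝ᵥ grad D f (c • z)) ≤ v ⬝ᵥ grad D f z := by
  rw [← smul_eq_mul, ← dotProduct_smul]
  exact dotProduct_le_dotProduct_of_nonneg_left
    (fun ℓ => minGradRatio_mul_grad_le hz hcz ℓ) hv

theorem ratioAt_le {d : ℕ} (hz : z ∈ admissible D f c) :
    ratioAt D f d c ≤ ((minGradRatio D f c z / (4 * Real.log (1 + 2 * (d : ℝ) ^ 2))
      - (z ⬝ᵥ grad D f z - f z) / f (c • z) : ℝ) : EReal) :=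
  iInf₂_le z hz

/-- If `f` is not constant on the orthant, then `ratioAt` never exceeds `1 / (4 ln (1 + 2 d²))`:
far out on a ray along which `f` grows, the expression is not much larger. -/
theorem ratioAt_le_of_lt (hD : Set.Ici 0 ⊆ D) (hf : ConvexOn ℝ D f) (hf' : DifferentiableOn ℝ f D)
    (hnonneg : ∀ x, 0 ≤ x → 0 ≤ f x) (hmono : MonotoneOn f (Set.Ici 0))
    (hgrad : ∀ x x' : Fin n → ℝ, 0 ≤ x' → x' ≤ x → ∀ ℓ, grad D f x' ℓ ≤ grad D f x ℓ)
    {v : Fin n → ℝ} (hv : 0 ≤ v) (hfv : f 0 < f v) (hgv : ∃ ℓ, 0 < grad D f v ℓ)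
    {d : ℕ} (hd : 1 ≤ d) (hc : 0 < c) {θ : ℝ}
    (hθ : 1 / (4 * Real.log (1 + 2 * (d : ℝ) ^ 2)) < θ) (hθ1 : θ ≤ 1) :
    ratioAt D f d c ≤ (θ : EReal) := by
  have hL := one_lt_log_one_add_two_mul_sq (d := (d : ℝ)) (by exact_mod_cast hd)
  set β := 1 / (4 * Real.log (1 + 2 * (d : ℝ) ^ 2)) with hβ
  have hβ0 : 0 < β := by positivity
  set p : ℝ → ℝ := fun s => v ⬝ᵥ grad D f (s • v) with hp
  have hmem : ∀ s : ℝ, 0 ≤ s → 0 ≤ s • v := fun s hs => smul_nonneg hs hv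
  have hg : ∀ s : ℝ, 0 ≤ s → 0 ≤ grad D f (s • v) := fun s hs =>
    grad_nonneg hD hf' hmono (hmem s hs)
  have htan : ∀ s t : ℝ, 0 ≤ s → 0 ≤ t → f (s • v) + (t - s) * p s ≤ f (t • v) := by
    intro s t hs ht
    have := add_dotProduct_grad_le hf hf' (hD (hmem s hs)) (hD (hmem t ht))
    rwa [← sub_smul, smul_dotProduct, smul_eq_mul] at this
  have hpmono : ∀ s t : ℝ, 0 ≤ s → s ≤ t → p s ≤ p t := fun s t hs hst =>
    dotProduct_le_dotProduct_of_nonneg_left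
      (fun ℓ => hgrad _ _ (hmem s hs) (smul_le_smul_of_nonneg_right hst hv) ℓ) hv
  set K := f 0
  have hK : 0 ≤ K := hnonneg 0 le_rfl
  have hp1 : 0 < p 1 := by
    have := htan 1 0 zero_le_one le_rfl
    rw [zero_smul, one_smul] at this
    linarith
  have htan0 : ∀ s : ℝ, 0 ≤ s → f (s • v) - s * p s ≤ K := by
    intro s hs
    have := htan s 0 hs le_rfl
    rw [zero_smul] at this
    linarith
  -- Far enough out, (θ - β)(c s - 1) p(1) ≥ 2K, so the error terms caused by K = f(0) are absorbed.
  obtain ⟨s, hs1, hcs1, hsK⟩ : ∃ s : ℝ, 1 ≤ s ∧ 1 ≤ c * s ∧ 2 * K / (θ - β) / p 1 + 1 ≤ c * s := by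
    set q := 2 * K / (θ - β) / p 1
    have hq : 0 ≤ q := div_nonneg (div_nonneg (by positivity) (by linarith)) hp1.le
    refine ⟨1 + (q + 1) / c, by simpa using div_nonneg (by linarith) hc.le, ?_, ?_⟩ <;>
      rw [mul_add, mul_div_cancel₀ _ hc.ne'] <;> linarith
  have hs0 : 0 ≤ s := by linarith
  have hcs0 : 0 ≤ c * s := by linarith
  have hvle : v ≤ (c * s) • v := by
    simpa using smul_le_smul_of_nonneg_right hcs1 hv
  have hN : 0 < f ((c * s) • v) := by
    linarith [hmono hv (hmem _ hcs0) hvle]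
  refine (ratioAt_le (z := s • v) ⟨hmem s hs0, by rwa [smul_smul], ?_⟩).trans
    (EReal.coe_le_coe_iff.2 ?_)
  · obtain ⟨ℓ, hℓ⟩ := hgv
    exact ⟨ℓ, hℓ.trans_le (by rw [smul_smul]; exact hgrad _ _ hv hvle ℓ)⟩
  have hR0 : 0 ≤ minGradRatio D f c (s • v) := minGradRatio_nonneg (hg s hs0)
  have hR := minGradRatio_mul_dotProduct_le (c := c) (hg s hs0)
    (by rw [smul_smul]; exact hg _ hcs0) hv
  rw [smul_smul] at hR ⊢
  rw [smul_dotProduct, smul_eq_mul, div_eq_mul_one_div, ← hβ]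
  change _ * p (c * s) ≤ p s at hR
  change _ - (s * p s - _) / _ ≤ _
  set R := minGradRatio D f c (s • v)
  set N := f ((c * s) • v)
  have hpcs : p 1 ≤ p (c * s) := hpmono 1 _ zero_le_one hcs1
  have hps : p 1 ≤ p s := hpmono 1 _ zero_le_one hs1
  have hlarge : 2 * K ≤ (θ - β) * ((c * s - 1) * p 1) := by
    have h1 : 2 * K / (θ - β) / p 1 ≤ c * s - 1 := by linarith
    rwa [div_le_iff₀ hp1, div_le_iff₀' (by linarith)] at h1
  rw [sub_le_iff_le_add, ← sub_le_iff_le_add', le_div_iff₀ hN, sub_mul]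
  have hNK : N - c * s * p (c * s) ≤ K := htan0 _ hcs0
  rcases le_total 1 c with h1c | h1c
  · have hle : p s ≤ p (c * s) := hpmono _ _ hs0 (le_mul_of_one_le_left hs0 h1c)
    have hR1 : R ≤ 1 := le_of_mul_le_mul_right (by linarith) (hp1.trans_le hpcs)
    have h2 : R * β * N ≤ β * N := by
      rw [mul_assoc]
      exact mul_le_of_le_one_left (by positivity) hR1
    have h3 := htan0 s hs0
    have h4 : (c * s - 1) * p 1 ≤ N := by
      have := htan 1 (c * s) zero_le_one hcs0
      rw [one_smul] at this
      linarith [hnonneg v hv]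
    have h5 := hlarge.trans (mul_le_mul_of_nonneg_left h4 (by linarith))
    linarith
  -- For c ≤ 1, R may exceed 1. The error is at most K + R K, and (θ - β) c s p(s) dominates both 2K
  -- and 2R K, hence their average.
  · have h2 := htan s (c * s) hs0 hcs0
    change _ ≤ N at h2
    have hle : p (c * s) ≤ p s := hpmono _ _ hcs0 (mul_le_of_le_one_left hs0 h1c)
    have hRp : R * p 1 ≤ p s := (mul_le_mul_of_nonneg_left hpcs hR0).trans hR
    have h3 : R * N ≤ R * K + c * s * p s := by
      have h := mul_le_mul_of_nonneg_left hNK hR0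
      have h' := mul_le_mul_of_nonneg_left hR hcs0
      linarith
    have h4 : N ≤ K + c * s * p s := by
      have := mul_le_mul_of_nonneg_left hle hcs0
      linarith
    have h5 : ∀ r, r * p 1 ≤ p s → r * (θ - β) * (c * s * p 1) ≤ (θ - β) * (c * s * p s) := by
      intro r hr
      have := mul_le_mul_of_nonneg_left hr (mul_nonneg (sub_nonneg.2 hθ.le) hcs0)
      linarith
    have h6 : 2 * K ≤ (θ - β) * (c * s * p 1) :=
      hlarge.trans (mul_le_mul_of_nonneg_left (by linarith) (by linarith))
    have h7 := h5 1 (by linarith)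
    have h8 := h5 R hRp
    have h9 := mul_le_mul_of_nonneg_left h6 hR0
    have h10 := mul_le_mul_of_nonneg_left h3 hβ0.le
    have h11 := mul_le_mul_of_nonneg_left h4 (sub_nonneg.2 hθ1)
    have h12 : β * (R * K) ≤ R * K :=
      mul_le_of_le_one_left (mul_nonneg hR0 hK) (hθ.le.trans hθ1)
    have h13 : 0 ≤ θ * K := mul_nonneg (hβ0.trans hθ).le hK
    linarith

end Ratio

/-! ### The primal guarantee and the dual certificate. -/

section Main

variable {m n : ℕ} {D : Set (Fin n → ℝ)} {f : (Fin n → ℝ) → ℝ} {A : Matrix (Fin m) (Fin n) ℝ}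
  {d : ℕ} {T : Fin (m + 1) → ℝ} {x : ℝ → Fin n → ℝ}

/-- The competitive ratio bounds the final value in terms of every feasible solution. -/
theorem IsRun.competitiveRatio_mul_le (hrun : IsRun D f A d T x) (hm : 0 < m)
    (hD : Set.Ici 0 ⊆ D) (hf : ConvexOn ℝ D f) (hf' : DifferentiableOn ℝ f D)
    (hnonneg : ∀ x, 0 ≤ x → 0 ≤ f x) (hmono : MonotoneOn f (Set.Ici 0))
    (hgrad : ∀ x x' : Fin n → ℝ, 0 ≤ x' → x' ≤ x → ∀ ℓ, grad D f x' ℓ ≤ grad D f x ℓ)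
    (hA : ∀ i j, 0 ≤ A i j) (hd : ∀ i, {j | A i j ≠ 0}.ncard ≤ d)
    {w : Fin n → ℝ} (hw : PrimalFeasible A w) :
    competitiveRatio D f d * ((f (x (T (Fin.last m))) : ℝ) : EReal) ≤ ((f w : ℝ) : EReal) := by
  have hd1 := hrun.one_le_sparsity hm hA hd
  have hL := one_lt_log_one_add_two_mul_sq (d := (d : ℝ)) (by exact_mod_cast hd1)
  obtain ⟨hlt, hpos⟩ := hrun.value_lt_and_exists_grad_pos hm hD hf' hmono hgrad hA hd1
  have hval := hrun.value_le hm hD hf hf' hmono hgrad hA hd hw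
  have hx0 := hrun.nonneg hd1 hA (Set.right_mem_Icc.2 hrun.end_nonneg)
  set xe := x (T (Fin.last m))
  set L := Real.log (1 + 2 * (d : ℝ) ^ 2)
  have hK : 0 ≤ f 0 := hnonneg 0 le_rfl
  have hF : 0 < f xe := hK.trans_lt hlt
  suffices h : competitiveRatio D f d ≤ ((f w / f xe : ℝ) : EReal) by
    refine (mul_le_mul_of_nonneg_right h (EReal.coe_nonneg.2 hF.le)).trans_eq ?_
    rw [← EReal.coe_mul, div_mul_cancel₀ _ hF.ne']
  refine iSup₂_le fun c hc => ?_
  rcases le_or_gt (4 * L * f 0) (f xe) with hcase | hcase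
  · set z := c⁻¹ • xe with hz
    have hz0 : 0 ≤ z := smul_nonneg (inv_nonneg.2 hc.le) hx0
    have hcz : c • z = xe := smul_inv_smul₀ hc.ne' xe
    refine (ratioAt_le (z := z) ⟨hz0, by rwa [hcz], by rwa [hcz]⟩).trans
      (EReal.coe_le_coe_iff.2 ?_)
    have hgz := grad_nonneg hD hf' hmono hz0
    have hgx := grad_nonneg hD hf' hmono hx0
    have hRw := minGradRatio_mul_dotProduct_le (c := c) hgz (by rwa [hcz]) hw.1
    have hR0 : 0 ≤ minGradRatio D f c z := minGradRatio_nonneg hgz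
    have htan := add_dotProduct_grad_le hf hf' (hD hz0) (hD hw.1)
    rw [hcz, dotProduct_comm] at hRw
    rw [sub_dotProduct] at htan
    rw [hcz, le_div_iff₀ hF, sub_mul, div_mul_cancel₀ _ hF.ne', div_mul_eq_mul_div]
    -- Here 4L f(0) ≤ f(x̄) gives (4L - 1) f(x̄) ≤ 4L (f(x̄) - f(0)), and the factor 4L - 1 cancels.
    have hgain : f xe ≤ 4 * L * (grad D f xe ⬝ᵥ w) := by
      have h1 : 4 * L * (f xe - f 0) ≤ 4 * L * ((4 * L - 1) * (grad D f xe ⬝ᵥ w)) :=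
        mul_le_mul_of_nonneg_left hval (by linarith)
      refine le_of_mul_le_mul_left (a := 4 * L - 1) ?_ (by linarith)
      linarith
    have : minGradRatio D f c z * f xe / (4 * L)
        ≤ minGradRatio D f c z * (grad D f xe ⬝ᵥ w) := by
      rw [div_le_iff₀ (by linarith)]
      have := mul_le_mul_of_nonneg_left hgain hR0
      linarith
    linarith
  · refine (ratioAt_le_of_lt (θ := f 0 / f xe) hD hf hf' hnonneg hmono hgrad hx0 hlt hpos hd1 hc
      ?_ ?_).trans (EReal.coe_le_coe_iff.2 ?_)
    · rw [div_lt_div_iff₀ (by linarith) hF]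
      linarith
    · exact (div_le_one hF).2 hlt.le
    · exact div_le_div_of_nonneg_right (hmono Set.self_mem_Ici hw.1 hw.1) hF.le

/-- A dual solution, fixed with hindsight, whose value certifies `ratioAt`. -/
theorem IsRun.exists_dualFeasible (hrun : IsRun D f A d T x) (hm : 0 < m)
    (hD : Set.Ici 0 ⊆ D) (hf : ConvexOn ℝ D f) (hf' : DifferentiableOn ℝ f D)
    (hmono : MonotoneOn f (Set.Ici 0))
    (hgrad : ∀ x x' : Fin n → ℝ, 0 ≤ x' → x' ≤ x → ∀ ℓ, grad D f x' ℓ ≤ grad D f x ℓ)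
    (hA : ∀ i j, 0 ≤ A i j) (hd : ∀ i, {j | A i j ≠ 0}.ncard ≤ d) (hf0 : f 0 = 0)
    {δ : ℝ} (hδ : 0 < δ) :
    ∃ y : Fin m → ℝ, DualFeasible A y (grad D f (δ • x (T (Fin.last m)))) ∧
      ratioAt D f d δ⁻¹ * ((f (x (T (Fin.last m))) : ℝ) : EReal)
        ≤ ((∑ i, y i : ℝ) : EReal)
          - fenchelDual D f (grad D f (δ • x (T (Fin.last m)))) := by
  have hd1 := hrun.one_le_sparsity hm hA hd
  have hL := one_lt_log_one_add_two_mul_sq (d := (d : ℝ)) (by exact_mod_cast hd1)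
  obtain ⟨hlt, hpos⟩ := hrun.value_lt_and_exists_grad_pos hm hD hf' hmono hgrad hA hd1
  have hval := fun w (hw : PrimalFeasible A w) =>
    hrun.value_le hm hD hf hf' hmono hgrad hA hd hw
  have hx0 := hrun.nonneg hd1 hA (Set.right_mem_Icc.2 hrun.end_nonneg)
  set xe := x (T (Fin.last m))
  set L := Real.log (1 + 2 * (d : ℝ) ^ 2)
  rw [hf0] at hlt
  set z := δ • xe with hz
  have hz0 : 0 ≤ z := smul_nonneg hδ.le hx0
  have hcz : δ⁻¹ • z = xe := inv_smul_smul₀ hδ.ne' xe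
  have hgz := grad_nonneg hD hf' hmono hz0
  have hgx := grad_nonneg hD hf' hmono hx0
  set R := minGradRatio D f δ⁻¹ z with hR
  have hR0 : 0 ≤ R := minGradRatio_nonneg hgz
  obtain ⟨y, hy, hsum⟩ := exists_packing_of_covering_bound hm A hgx
    (V := f xe / (4 * L)) (by positivity) fun w hw => by
      rw [div_le_iff₀ (by linarith)]
      have := hval w hw
      have := dotProduct_nonneg_of_nonneg hgx hw.1
      linarith
  -- R ∇f(x̄) ≤ ∇f(δx̄) coordinatewise, so scaling by R carries feasibility over.
  refine ⟨R • y, ⟨smul_nonneg hR0 hy.1, fun j => ?_⟩, ?_⟩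
  · rw [Matrix.smul_vecMul]
    refine (mul_le_mul_of_nonneg_left (hy.2 j) hR0).trans ?_
    have := minGradRatio_mul_grad_le (c := δ⁻¹) hgz (by rwa [hcz]) j
    rwa [hcz] at this
  · refine (mul_le_mul_of_nonneg_right
      (ratioAt_le (z := z) ⟨hz0, by rwa [hcz], by rwa [hcz]⟩)
      (EReal.coe_nonneg.2 hlt.le)).trans_eq ?_
    rw [fenchelDual_grad hf hf' (hD hz0), ← EReal.coe_mul, ← EReal.coe_sub, hcz, sub_mul,
      div_mul_cancel₀ _ hlt.ne', ← hR, dotProduct_comm z]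
    simp only [Pi.smul_apply, smul_eq_mul, ← Finset.mul_sum, hsum]
    congr 2
    ring

end Main

end OnlineCovering

theorem mainTheorem3 {m n : ℕ} (hm : 0 < m)
    (D : Set (Fin n → ℝ)) (hD : Set.Ici 0 ⊆ D)
    (f : (Fin n → ℝ) → ℝ)
    (hf_convex : ConvexOn ℝ D f)
    (hf_diff : DifferentiableOn ℝ f D)
    (hf_nonneg : ∀ x, 0 ≤ x → 0 ≤ f x)
    (hf_mono : MonotoneOn f (Set.Ici 0))
    (hf_grad : ∀ x x' : Fin n → ℝ, 0 ≤ x' → x' ≤ x →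
      ∀ ℓ, OnlineCovering.grad D f x' ℓ ≤ OnlineCovering.grad D f x ℓ)
    (A : Matrix (Fin m) (Fin n) ℝ) (hA : ∀ i j, 0 ≤ A i j)
    (d : ℕ) (hd : ∀ i, {j | A i j ≠ 0}.ncard ≤ d)
    (T : Fin (m + 1) → ℝ) (x : ℝ → Fin n → ℝ)
    (hrun : OnlineCovering.IsRun D f A d T x) :
    -- the primal solution never decreases, and it is feasible in the end
    MonotoneOn x (Set.Icc 0 (T (Fin.last m))) ∧
    OnlineCovering.PrimalFeasible A (x (T (Fin.last m))) ∧
    -- its value is within the stated ratio of every offline solution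
    (∀ x' : Fin n → ℝ, OnlineCovering.PrimalFeasible A x' →
      OnlineCovering.competitiveRatio D f d * ((f (x (T (Fin.last m))) : ℝ) : EReal)
        ≤ ((f x' : ℝ) : EReal)) ∧
    -- for `f 0 = 0`, the ratio of every `c = 1 / δ` is that of the primal value to the value of a
    -- dual solution whose `μ` is `∇ f (δ x̄)`, where `x̄` is the final primal solution
    (f 0 = 0 → ∀ δ : ℝ, 0 < δ → ∃ y : Fin m → ℝ,
      OnlineCovering.DualFeasible A y
        (OnlineCovering.grad D f (δ • x (T (Fin.last m)))) ∧
      OnlineCovering.ratioAt D f d δ⁻¹ * ((f (x (T (Fin.last m))) : ℝ) : EReal)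
        ≤ ((∑ i, y i : ℝ) : EReal)
          - OnlineCovering.fenchelDual D f
              (OnlineCovering.grad D f (δ • x (T (Fin.last m))))) := by
  have hd1 := hrun.one_le_sparsity hm hA hd
  exact ⟨hrun.monotoneOn hd1 hA, hrun.end_primalFeasible hd1 hA,
    fun w hw => hrun.competitiveRatio_mul_le hm hD hf_convex hf_diff hf_nonneg hf_mono hf_grad
      hA hd hw,
    fun hf0 δ hδ => hrun.exists_dualFeasible hm hD hf_convex hf_diff hf_mono hf_grad hA hd hf0 hδ⟩
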